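/- Fix $d\ge 1$ and let $S,P,Q$ be copies of $\mathbb{C}^d$. Let $|\Gamma\rangle=\sum_i|i\rangle|i\rangle\in\mathbb{C}^d\otimes\mathbb{C}^d$, let $\mathsf{SWAP}=\sum_{i,j}|i\rangle\langle j|\otimes|j\rangle\langle i|$, and for an operator $K$ let $\mathcal{D}_K(X)=KXK^\dagger-\tfrac12\{K^\dagger K,X\}$ be the Lindbladian generated by $K$, with semigroup $e^{\mathcal{D}_K s}(X)=\sum_{k\ge0}\mathcal{D}_K^k(X)s^k/k!$. Put $$M=\frac1{\sqrt d}\,\bigl(I_S\otimes|\Gamma\rangle\langle\Gamma|_{PQ}\bigr)\bigl(\mathsf{SWAP}_{SP}\otimes I_Q\bigr).$$ For a $d\times d$ matrix $L$ with Hilbert--Schmidt norm $\|L\|_2=1$, let $\psi=|\psi\rangle\langle\psi|$ be the program state with $|\psi\rangle=(L\otimes I)|\Gamma\rangle\in P\otimes Q$, and let $\mathcal{L}=\mathcal{D}_L$, that is, $\mathcal{L}(\rho)=L\rho L^\dagger-\tfrac12\{L^\dagger L,\rho\}$. For $t\ge0$ and $n\ge1$ let $$\mathcal{T}(\rho)=\operatorname{Tr}_{PQ}\bigl[e^{\mathcal{D}_M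 t/n}(\rho\otimes\psi)\bigr],\qquad \mathcal{A}_n=\mathcal{T}^{\,n},$$ the $n$-fold composition; so $\mathcal{A}_n$ uses $n$ copies of $\psi$, one in each step. For linear maps $\mathcal{N}_1,\mathcal{N}_2$ on the operators on $S$ let $\|\mathcal{N}_1-\mathcal{N}_2\|_\diamond=\sup\|(\mathcal{I}_R\otimes\mathcal{N}_1)(\rho)-(\mathcal{I}_R\otimes\mathcal{N}_2)(\rho)\|_1$, where the supremum is over all finite-dimensional reference systems $R$ and all density matrices $\rho$ on $R\otimes S$, and $\|\cdot\|_1$ is the trace norm. Theorem. For every $d$ there is a constant $C>0$, depending only on $d$, such that for all $L$ with $\|L\|_2=1$, all $t\ge0$ and all $0<\varepsilon<1$ there is an integer $n_0\ge1$ with $n_0\le C\,t^2/\varepsilon+1$ such that, for every $n\ge n_0$, $$\tfrac12\bigl\|e^{\mathcal{L}t}-\mathcal{A}_n\bigr\|_\diamond\le\varepsilon .$$ In particular, $n=O(t^2/\varepsilon)$ copies of $\psi$ (rounded up to an integer) suffice to simulate $e^{\mathcal{L}t}$ to within $\varepsilon$ in normalized diamond distance. -/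

import Mathlib

open scoped Kronecker Matrix Nat ENNReal ComplexOrder

namespace WaveMatrix

/-- The complex matrices on a finite index type, i.e. the operators on the Hilbert space `ℂ^m`. -/
abbrev Op (m : Type*) := Matrix m m ℂ

/-- The superoperators: the linear maps from operators on `ℂ^m` to operators on `ℂ^k`. -/
abbrev SuperOp (m k : Type*) := Op m →ₗ[ℂ] Op k

/-- A quantum state (density matrix): positive semidefinite with unit trace. -/
def IsState {m : Type*} [Fintype m] (ρ : Op m) : Prop :=
  ρ.PosSemidef ∧ ρ.trace = 1

/-- The Schatten `p`-norm `(Tr[(X†X)^{p/2}])^{1/p}`; the power of the positive semidefinite matrix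
`X†X` is taken in the continuous functional calculus, and the trace is a nonnegative real. -/
noncomputable def schattenNorm {m : Type*} [Fintype m] [DecidableEq m] (p : ℝ) (X : Op m) : ℝ :=
  (Matrix.trace (cfc (fun x : ℝ => x ^ (p / 2)) (Xᴴ * X))).re ^ (1 / p)

/-- The map `I_R ⊗ N`, applied to an operator `X` on `R ⊗ S`: the superoperator `N` acts on each
block `⟨r| X |r'⟩`, which is an operator on `S`. -/
def ampliate {R m k : Type*} (N : SuperOp m k) (X : Op (R × m)) : Op (R × k) :=
  Matrix.of fun a b => N (Matrix.of fun i j => X (a.1, i) (b.1, j)) a.2 b.2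

/-- The diamond distance `‖N₁ - N₂‖_⋄`: the supremum, over reference systems `R` of arbitrary finite
dimension and over joint states `ρ` of `R ⊗ S`, of `‖(I_R ⊗ N₁)(ρ) - (I_R ⊗ N₂)(ρ)‖₁`.
It is valued in `[0, ∞]`, so that the supremum always exists. -/
noncomputable def diamondDist {m k : Type*} [Fintype m] [Fintype k] [DecidableEq k]
    (N₁ N₂ : SuperOp m k) : ℝ≥0∞ :=
  ⨆ (r : ℕ) (ρ : Op (Fin r × m)) (_ : IsState ρ),
    ENNReal.ofReal (schattenNorm 1 (ampliate N₁ ρ - ampliate N₂ ρ))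

/-- The Lindbladian with the single Lindblad operator `L`:
`ρ ↦ L ρ L† - (1/2) {L†L, ρ}`. -/
noncomputable def lindbladian {m : Type*} [Fintype m] (L : Op m) : SuperOp m m where
  toFun ρ := L * ρ * Lᴴ - (1 / 2 : ℂ) • (Lᴴ * L * ρ + ρ * (Lᴴ * L))
  map_add' X Y := by
    simp only [mul_add, add_mul, smul_add]
    abel
  map_smul' c X := by
    simp only [Matrix.mul_smul, Matrix.smul_mul, RingHom.id_apply, ← smul_add, smul_sub]
    rw [smul_comm c]

/-- The exponential series of a linear map on a finite-dimensional normed space converges at every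
vector. -/
theorem summable_exp_series {E : Type*} [NormedAddCommGroup E] [NormedSpace ℂ E]
    [FiniteDimensional ℂ E] (K : E →ₗ[ℂ] E) (t : ℝ) (X : E) :
    Summable fun k : ℕ => ((t : ℂ) ^ k / (k ! : ℂ)) • (K ^ k) X := by
  obtain ⟨c, hc0, hc⟩ : ∃ c : ℝ, 0 ≤ c ∧ ∀ Y, ‖K Y‖ ≤ c * ‖Y‖ :=
    ⟨‖LinearMap.toContinuousLinearMap K‖, norm_nonneg _,
      (LinearMap.toContinuousLinearMap K).le_opNorm⟩
  refine Summable.of_norm_bounded (g := fun k : ℕ => ((|t| * c) ^ k / (k ! : ℝ)) * ‖X‖)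
    ((Real.summable_pow_div_factorial (|t| * c)).mul_right _) fun k => ?_
  have h1 : ‖(K ^ k) X‖ ≤ c ^ k * ‖X‖ := by
    induction k with
    | zero => simp
    | succ k ih =>
      rw [pow_succ', pow_succ', mul_assoc]
      exact (hc _).trans (mul_le_mul_of_nonneg_left ih hc0)
  have h2 : ‖((t : ℂ) ^ k / (k ! : ℂ))‖ = |t| ^ k / (k ! : ℝ) := by
    simp [norm_pow]
  rw [norm_smul, h2, mul_pow, mul_div_right_comm, mul_assoc]
  exact mul_le_mul_of_nonneg_left h1 (by positivity)

/-- The exponential series of a superoperator converges at every operator. -/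
theorem summable_semigroup {m : Type*} [Fintype m] (K : SuperOp m m) (t : ℝ) (X : Op m) :
    Summable fun k : ℕ => ((t : ℂ) ^ k / (k ! : ℂ)) • (K ^ k) X :=
  @summable_exp_series (Op m) Matrix.normedAddCommGroup Matrix.normedSpace _ K t X

/-- The exponential `e^{K t}` of a superoperator: `X ↦ ∑_k K^k(X) t^k / k!`. -/
noncomputable def semigroup {m : Type*} [Fintype m] (K : SuperOp m m) (t : ℝ) : SuperOp m m where
  toFun X := ∑' k : ℕ, ((t : ℂ) ^ k / (k ! : ℂ)) • (K ^ k) X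
  map_add' X Y := by
    rw [← (summable_semigroup K t X).tsum_add (summable_semigroup K t Y)]
    simp only [map_add, smul_add]
  map_smul' c X := by
    rw [RingHom.id_apply, ← (summable_semigroup K t X).tsum_const_smul c]
    simp only [map_smul]
    exact tsum_congr fun k => smul_comm _ c _

/-- The partial trace over the second tensor factor. -/
def partialTrace {m k : Type*} [Fintype k] : SuperOp (m × k) m where
  toFun X := Matrix.of fun i j => ∑ a, X (i, a) (j, a)
  map_add' X Y := by
    ext i j
    exact Finset.sum_add_distrib
  map_smul' c X := by
    ext i j
    exact (Finset.mul_sum Finset.univ (fun a => X (i, a) (j, a)) c).symm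

/-- Appending a system in the state `σ`: `ρ ↦ ρ ⊗ σ`. -/
def append {m k : Type*} (σ : Op k) : SuperOp m (m × k) where
  toFun ρ := ρ ⊗ₖ σ
  map_add' X Y := Matrix.add_kronecker X Y σ
  map_smul' c X := Matrix.smul_kronecker c X σ

/-- The rank-one operator `|v⟩⟨v|`. -/
def ketbra {m : Type*} (v : m → ℂ) : Op m := Matrix.vecMulVec v (star v)

/-- The unnormalized maximally entangled vector `|Γ⟩ = ∑_i |i⟩|i⟩` of `ℂ^d ⊗ ℂ^d`. -/
def maxEnt (d : ℕ) : Fin d × Fin d → ℂ :=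
  ∑ i : Fin d, Pi.single (i, i) 1

/-- The swap operator `∑_{i,j} |i⟩⟨j| ⊗ |j⟩⟨i|`. -/
def swapOp (d : ℕ) : Op (Fin d × Fin d) :=
  ∑ i : Fin d, ∑ j : Fin d, Matrix.single i j (1 : ℂ) ⊗ₖ Matrix.single j i (1 : ℂ)

/-- The program state `ψ = |ψ⟩⟨ψ|` on `P ⊗ Q`, with `|ψ⟩ = (L ⊗ I)|Γ⟩`, that encodes `L`. -/
def programState {d : ℕ} (L : Op (Fin d)) : Op (Fin d × Fin d) :=
  ketbra ((L ⊗ₖ (1 : Op (Fin d))) *ᵥ maxEnt d)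

/-- The Lindblad operator `M = d^{-1/2} (I_S ⊗ |Γ⟩⟨Γ|_{PQ}) (SWAP_{SP} ⊗ I_Q)` on `S ⊗ (P ⊗ Q)`.
It does not depend on the encoded operator. -/
noncomputable def fixedLindbladOp (d : ℕ) : Op (Fin d × (Fin d × Fin d)) :=
  ((1 / Real.sqrt d : ℝ) : ℂ) •
    (((1 : Op (Fin d)) ⊗ₖ ketbra (maxEnt d)) *
      Matrix.reindex (Equiv.prodAssoc (Fin d) (Fin d) (Fin d))
        (Equiv.prodAssoc (Fin d) (Fin d) (Fin d)) (swapOp d ⊗ₖ (1 : Op (Fin d))))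

/-- One step of the algorithm: append a program register in the state `σ`, evolve under the
Lindbladian generated by `M` for the time `Δ`, and trace out the program register. -/
noncomputable def step {d : ℕ} (Δ : ℝ) (σ : Op (Fin d × Fin d)) : SuperOp (Fin d) (Fin d) :=
  partialTrace ∘ₗ semigroup (lindbladian (fixedLindbladOp d)) Δ ∘ₗ append σ

/-- The algorithm, run for total time `t` on a supply of program states: it makes one step of
duration `t / n` with each of them, where `n` is their number. -/
noncomputable def algorithm {d : ℕ} (t : ℝ) (supply : List (Op (Fin d × Fin d))) :
    SuperOp (Fin d) (Fin d) :=
  supply.foldl (fun N σ => step (t / supply.length) σ ∘ₗ N) LinearMap.id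

end WaveMatrix

/-! To first order in time one step already is the target evolution: tracing out `PQ` from `D_M(ρ ⊗
ψ)` leaves `D_L(ρ)` (`partialTrace_lindbladian_append`). A step of duration `Δ = t/n` therefore
differs from `e^{LΔ}` only by second-order remainders, of size `O(Δ²)`. Channels do not amplify
errors, so `n` steps cost at most `n · O((t/n)²) = O(t²/n)`.

Trace norms are handled through order bounds: `-F ≤ X ≤ F` gives `‖X‖₁ ≤ Tr F`. Such bounds add, and
positive trace-preserving maps carry them along (`Dominated.map`).

For the remainder, a Lindbladian is written as a difference `P - N` of positive maps. Then `(P +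
N)^j X` dominates `(P - N)^j X`, and its trace grows at most like `κ^j` (`dominated_semigroupTail`).
The constants are uniform in the reference system because ampliation turns `D_L` into `D_{1 ⊗ L}`,
and `L†L ≤ c` survives tensoring with the identity. -/

namespace WaveMatrix

/-! ### Positive semidefinite matrices and Schatten norms -/

/-- The positive semidefinite matrices form a closed set. -/
theorem isClosed_setOf_posSemidef {m : Type*} [Fintype m] :
    IsClosed {A : Op m | A.PosSemidef} := by
  simp only [Matrix.posSemidef_iff_dotProduct_mulVec, Set.ofPred_and, Set.ofPred_forall]
  refine IsClosed.inter ?_ (isClosed_iInter fun x => ?_)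
  · exact isClosed_eq (by fun_prop) continuous_id
  · exact isClosed_le continuous_const (by fun_prop)

theorem trace_mul_nonneg {m : Type*} [Fintype m] {A B : Op m} (hA : A.PosSemidef)
    (hB : B.PosSemidef) : 0 ≤ (A * B).trace := by
  classical
  open scoped MatrixOrder in
  obtain ⟨C, rfl⟩ := CStarAlgebra.nonneg_iff_eq_star_mul_self.mp hA.nonneg
  rw [Matrix.trace_mul_comm, Matrix.star_eq_conjTranspose, ← Matrix.mul_assoc,
    Matrix.trace_mul_comm, ← Matrix.mul_assoc]
  exact (hB.mul_mul_conjTranspose_same C).trace_nonneg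

/-- If `-F ≤ X ≤ F`, then the trace norm of `X` is at most the trace of `F`. -/
theorem schattenNorm_one_le_trace {m : Type*} [Fintype m] [DecidableEq m] {X F : Op m}
    (hp : (F + X).PosSemidef) (hm : (F - X).PosSemidef) : schattenNorm 1 X ≤ F.trace.re := by
  have hX : X.IsHermitian := by
    have h : X = (1 / 2 : ℝ) • ((F + X) - (F - X)) := by
      rw [add_sub_sub_cancel, ← two_smul ℝ X, smul_smul]; norm_num
    rw [h]
    exact (hp.1.sub hm.1).smul (IsSelfAdjoint.all _)
  -- For Hermitian `X` the root of `X†X = X²` is `|X|`.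
  have hcfc : cfc (fun x : ℝ => x ^ ((1 : ℝ) / 2)) (Xᴴ * X) = hX.cfc (fun x => |x|) := by
    have hsa : IsSelfAdjoint X := hX
    rw [hX.eq, ← sq, ← hX.cfc_eq, ← cfc_comp_pow (fun x : ℝ => x ^ ((1 : ℝ) / 2)) 2 X]
    · congr 1
      ext x
      rw [← Real.sqrt_eq_rpow, Real.sqrt_sq_eq_abs]
  set U : Op m := hX.eigenvectorUnitary.1 with hU
  have hUU : star U * U = 1 := Unitary.coe_star_mul_self hX.eigenvectorUnitary
  have hUU' : U * star U = 1 := Unitary.coe_mul_star_self hX.eigenvectorUnitary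
  have htr : (hX.cfc (fun x => |x|)).trace = ((∑ i, |hX.eigenvalues i| : ℝ) : ℂ) := by
    rw [Matrix.IsHermitian.cfc, Unitary.conjStarAlgAut_apply, Matrix.trace_mul_comm,
      ← Matrix.mul_assoc]
    change (star U * U * Matrix.diagonal _).trace = _
    rw [hUU, Matrix.one_mul]
    simp [Matrix.trace]
  have hdiag : star U * X * U = Matrix.diagonal (RCLike.ofReal ∘ hX.eigenvalues) := by
    conv_lhs => rw [hX.spectral_theorem, Unitary.conjStarAlgAut_apply]
    rw [← Unitary.coe_star, ← hU, Unitary.coe_star, ← hU]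
    simp only [Matrix.mul_assoc]
    rw [hUU, Matrix.mul_one, ← Matrix.mul_assoc, hUU, Matrix.one_mul]
  have hF : (star U * F * U).trace = F.trace := by
    rw [Matrix.trace_mul_comm, ← Matrix.mul_assoc, hUU', Matrix.one_mul]
  -- In an eigenbasis of `X` the order bounds, read on the diagonal, say that each diagonal entry of
  -- `F` is at least the modulus of the eigenvalue.
  have hi : ∀ i, |hX.eigenvalues i| ≤ ((star U * F * U) i i).re := fun i => by
    have h1 := (hp.conjTranspose_mul_mul_same U).diag_nonneg (i := i)
    have h2 := (hm.conjTranspose_mul_mul_same U).diag_nonneg (i := i)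
    rw [← Matrix.star_eq_conjTranspose, Matrix.mul_add, Matrix.add_mul, hdiag] at h1
    rw [← Matrix.star_eq_conjTranspose, Matrix.mul_sub, Matrix.sub_mul, hdiag] at h2
    have h1' := (Complex.le_def.1 h1).1
    have h2' := (Complex.le_def.1 h2).1
    simp at h1' h2'
    rw [abs_le]
    constructor <;> linarith
  unfold schattenNorm
  rw [hcfc, htr, Complex.ofReal_re, div_one, Real.rpow_one, ← hF, Matrix.trace, Complex.re_sum]
  exact Finset.sum_le_sum fun i _ => hi i

theorem schattenNorm_two_eq_one {m : Type*} [Fintype m] [DecidableEq m] {L : Op m}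
    (hL : schattenNorm 2 L = 1) : (Lᴴ * L).trace = 1 := by
  have hps := Matrix.posSemidef_conjTranspose_mul_self L
  have hsa : IsSelfAdjoint (Lᴴ * L) := hps.1
  have htn := hps.trace_nonneg
  have h : cfc (fun x : ℝ => x ^ ((2 : ℝ) / 2)) (Lᴴ * L) = Lᴴ * L := by
    simp only [div_self (two_ne_zero' ℝ), Real.rpow_one]
    exact cfc_id' ℝ _
  unfold schattenNorm at hL
  rw [h, ← Real.sqrt_eq_rpow, Real.sqrt_eq_one] at hL
  exact Complex.ext hL (Complex.le_def.1 htn).2.symm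

/-! ### The exponential of a linear map -/

section Exponential

variable {E : Type*} [NormedAddCommGroup E] [NormedSpace ℂ E] [FiniteDimensional ℂ E]

/-- The exponential series of a linear map, applied to a vector. -/
noncomputable def expApply (K : E →ₗ[ℂ] E) (t : ℝ) (X : E) : E :=
  ∑' k : ℕ, ((t : ℂ) ^ k / (k ! : ℂ)) • (K ^ k) X

/-- The Banach algebra of continuous endomorphisms supplies the functional equation and the
continuity of the pointwise series. -/
theorem expApply_eq_exp (K : E →ₗ[ℂ] E) (t : ℝ) (X : E) :
    expApply K t X = NormedSpace.exp ((t : ℂ) • LinearMap.toContinuousLinearMap K) X := by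
  have : CompleteSpace E := FiniteDimensional.complete ℂ E
  have h := NormedSpace.exp_series_hasSum_exp' (𝕂 := ℂ)
    ((t : ℂ) • LinearMap.toContinuousLinearMap K)
  have h2 := h.mapL (ContinuousLinearMap.apply ℂ E X)
  rw [ContinuousLinearMap.apply_apply] at h2
  rw [← h2.tsum_eq, expApply]
  refine tsum_congr fun k => ?_
  have hk : ∀ k : ℕ, ((LinearMap.toContinuousLinearMap K) ^ k) X = (K ^ k) X := fun k => by
    induction k with
    | zero => rfl
    | succ k ih => rw [pow_succ', pow_succ', Module.End.mul_apply, ← ih]; rfl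
  rw [ContinuousLinearMap.apply_apply, smul_pow, smul_smul, div_eq_mul_inv, mul_comm]
  exact congrArg _ (hk k).symm

theorem exp_smul_natCast_mul (K : E →L[ℂ] E) (n : ℕ) (t : ℝ) :
    NormedSpace.exp (((n * t : ℝ) : ℂ) • K) = NormedSpace.exp ((t : ℂ) • K) ^ n := by
  have : CompleteSpace E := FiniteDimensional.complete ℂ E
  let : NormedAlgebra ℚ (E →L[ℂ] E) := NormedAlgebra.restrictScalars ℚ ℂ _
  rw [← NormedSpace.exp_nsmul, ← Nat.cast_smul_eq_nsmul ℂ, smul_smul]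
  norm_num

theorem exp_smul_sub_smul_one (K : E →L[ℂ] E) (c t : ℝ) :
    NormedSpace.exp ((t : ℂ) • (K - (c : ℂ) • 1)) =
      (Real.exp (-(t * c)) : ℂ) • NormedSpace.exp ((t : ℂ) • K) := by
  have : CompleteSpace E := FiniteDimensional.complete ℂ E
  let : NormedAlgebra ℚ (E →L[ℂ] E) := NormedAlgebra.restrictScalars ℚ ℂ _
  have h : (t : ℂ) • (K - (c : ℂ) • 1) =
      algebraMap ℂ (E →L[ℂ] E) ((-(t * c) : ℝ) : ℂ) + (t : ℂ) • K := by
    rw [Algebra.algebraMap_eq_smul_one, smul_sub, smul_smul, sub_eq_neg_add, ← neg_smul]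
    norm_num
  rw [h, NormedSpace.exp_add_of_commute (Algebra.commutes _ _), 
    ← NormedSpace.algebraMap_exp_comm, ← Complex.exp_eq_exp_ℂ,
    Complex.ofReal_exp, Algebra.algebraMap_eq_smul_one, smul_mul_assoc, one_mul]

theorem tendsto_exp_smul_add_smul (K A : E →L[ℂ] E) (t : ℝ) (X : E) :
    Filter.Tendsto (fun s : ℝ => NormedSpace.exp ((t : ℂ) • (K + (s : ℂ) • A)) X)
      (nhdsWithin 0 (Set.Ioi 0)) (nhds (NormedSpace.exp ((t : ℂ) • K) X)) := by
  have : CompleteSpace E := FiniteDimensional.complete ℂ E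
  let : NormedAlgebra ℚ (E →L[ℂ] E) := NormedAlgebra.restrictScalars ℚ ℂ _
  have h : Continuous (fun s : ℝ => NormedSpace.exp ((t : ℂ) • (K + (s : ℂ) • A)) X) := by
    have h1 : Continuous (fun s : ℝ => (t : ℂ) • (K + (s : ℂ) • A)) := by fun_prop
    exact (ContinuousLinearMap.apply ℂ E X).continuous.comp (NormedSpace.exp_continuous.comp h1)
  simpa using (h.tendsto 0).mono_left nhdsWithin_le_nhds

theorem expApply_natCast_mul (K : E →ₗ[ℂ] E) (n : ℕ) (t : ℝ) :
    expApply K (n * t) = (expApply K t)^[n] := by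
  ext1 X
  rw [expApply_eq_exp, exp_smul_natCast_mul]
  induction n with
  | zero => rfl
  | succ n ih => rw [pow_succ', Function.iterate_succ_apply', ← ih, expApply_eq_exp]; rfl

theorem expApply_sub_smul_one (K : E →ₗ[ℂ] E) (c t : ℝ) (X : E) :
    expApply (K - (c : ℂ) • 1) t X = (Real.exp (-(t * c)) : ℂ) • expApply K t X := by
  have h : LinearMap.toContinuousLinearMap (K - (c : ℂ) • 1) =
      LinearMap.toContinuousLinearMap K - (c : ℂ) • 1 := rfl
  rw [expApply_eq_exp, expApply_eq_exp, h, exp_smul_sub_smul_one]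
  rfl

theorem tendsto_expApply_add_smul (K A : E →ₗ[ℂ] E) (t : ℝ) (X : E) :
    Filter.Tendsto (fun s : ℝ => expApply (K + (s : ℂ) • A) t X)
      (nhdsWithin 0 (Set.Ioi 0)) (nhds (expApply K t X)) := by
  simp only [expApply_eq_exp]
  exact tendsto_exp_smul_add_smul (LinearMap.toContinuousLinearMap K)
    (LinearMap.toContinuousLinearMap A) t X

end Exponential

/-! ### Positive superoperators and Lindblad semigroups -/

variable {m k : Type*} [Fintype m] [Fintype k]

theorem semigroup_natCast_mul (K : SuperOp m m) (n : ℕ) (t : ℝ) :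
    semigroup K (n * t) = semigroup K t ^ n := by
  refine LinearMap.ext fun X => ?_
  rw [Module.End.pow_apply]
  exact congrFun
    (@expApply_natCast_mul (Op m) Matrix.normedAddCommGroup Matrix.normedSpace _ K n t) X

theorem semigroup_sub_smul_one (K : SuperOp m m) (c t : ℝ) (X : Op m) :
    semigroup (K - (c : ℂ) • 1) t X = (Real.exp (-(t * c)) : ℂ) • semigroup K t X :=
  @expApply_sub_smul_one (Op m) Matrix.normedAddCommGroup Matrix.normedSpace _ K c t X

theorem tendsto_semigroup_add_smul (K A : SuperOp m m) (t : ℝ) (X : Op m) :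
    Filter.Tendsto (fun s : ℝ => semigroup (K + (s : ℂ) • A) t X)
      (nhdsWithin 0 (Set.Ioi 0)) (nhds (semigroup K t X)) :=
  @tendsto_expApply_add_smul (Op m) Matrix.normedAddCommGroup Matrix.normedSpace _ K A t X

/-- The superoperator `X ↦ A X A†`. -/
def conjugation (A : Op m) : SuperOp m m where
  toFun X := A * X * Aᴴ
  map_add' X Y := by rw [Matrix.mul_add, Matrix.add_mul]
  map_smul' c X := by simp

@[simp]
theorem conjugation_apply (A X : Op m) : conjugation A X = A * X * Aᴴ := rfl

theorem lindbladian_apply (L X : Op m) :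
    lindbladian L X = L * X * Lᴴ - (1 / 2 : ℂ) • (Lᴴ * L * X + X * (Lᴴ * L)) := rfl

/-- A superoperator is positive if it maps positive semidefinite operators to such operators. -/
def IsPositive (N : SuperOp m k) : Prop := ∀ X : Op m, X.PosSemidef → (N X).PosSemidef

theorem isPositive_conjugation (A : Op m) : IsPositive (conjugation A) :=
  fun _ hX => hX.mul_mul_conjTranspose_same A

omit [Fintype m] [Fintype k] in
theorem IsPositive.add {N₁ N₂ : SuperOp m k} (h₁ : IsPositive N₁) (h₂ : IsPositive N₂) :
    IsPositive (N₁ + N₂) := fun X hX => (h₁ X hX).add (h₂ X hX)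

omit [Fintype m] [Fintype k] in
theorem IsPositive.smul {N : SuperOp m k} (h : IsPositive N) {c : ℂ} (hc : 0 ≤ c) :
    IsPositive (c • N) := fun X hX => (h X hX).smul hc

omit [Fintype m] in
theorem IsPositive.pow {N : SuperOp m m} (h : IsPositive N) (j : ℕ) : IsPositive (N ^ j) := by
  induction j with
  | zero => exact fun X hX => hX
  | succ j ih =>
    intro X hX
    rw [pow_succ', Module.End.mul_apply]
    exact h _ (ih X hX)

theorem posSemidef_tsum {f : ℕ → Op m} (hf : Summable f) (h : ∀ j, (f j).PosSemidef) :
    (∑' j, f j).PosSemidef :=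
  isClosed_setOf_posSemidef.mem_of_tendsto hf.hasSum
    (Filter.Eventually.of_forall fun s => Matrix.posSemidef_sum s fun j _ => h j)

theorem pow_div_factorial_nonneg {t : ℝ} (ht : 0 ≤ t) (j : ℕ) :
    (0 : ℂ) ≤ (t : ℂ) ^ j / (j ! : ℂ) := by
  have h : ((t : ℂ) ^ j / (j ! : ℂ)) = ((t ^ j / (j ! : ℝ) : ℝ) : ℂ) := by push_cast; rfl
  rw [h, Complex.zero_le_real]
  positivity

theorem IsPositive.semigroup {K : SuperOp m m} (hK : IsPositive K) {t : ℝ} (ht : 0 ≤ t) :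
    IsPositive (semigroup K t) := fun X hX =>
  posSemidef_tsum (summable_semigroup K t X) fun j =>
    (hK.pow j X hX).smul (pow_div_factorial_nonneg ht j)

/-- With `G = L†L/2`, completing the square gives `D_L + s G·G = L·L† + (s^{-1/2} - s^{1/2}
G)·(s^{-1/2} - s^{1/2} G) - s^{-1}`. The two conjugations generate a positive semigroup term by
term, and the scalar shift only contributes the factor `e^{-t/s} > 0`. Letting `s → 0⁺` removes the
perturbation, since the positive cone is closed. -/
theorem isPositive_semigroup_lindbladian (L : Op m) {t : ℝ} (ht : 0 ≤ t) :
    IsPositive (semigroup (lindbladian L) t) := by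
  classical
  intro X hX
  set G : Op m := (1 / 2 : ℂ) • (Lᴴ * L) with hG
  have hGG : Gᴴ = G := by
    rw [hG, Matrix.conjTranspose_smul, Matrix.conjTranspose_mul, Matrix.conjTranspose_conjTranspose]
    norm_num
  refine isClosed_setOf_posSemidef.mem_of_tendsto
    (tendsto_semigroup_add_smul (lindbladian L) (conjugation G) t X) ?_
  filter_upwards [self_mem_nhdsWithin] with s hs
  have hs : 0 < s := hs
  set r : ℝ := Real.sqrt s
  have hr : 0 < r := Real.sqrt_pos.2 hs
  have hrs : s = r ^ 2 := (Real.sq_sqrt hs.le).symm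
  have hrc : (r : ℂ) ≠ 0 := Complex.ofReal_ne_zero.2 hr.ne'
  have key : lindbladian L + (s : ℂ) • conjugation G =
      (conjugation L + conjugation (((r⁻¹ : ℝ) : ℂ) • 1 - (r : ℂ) • G)) -
        ((s⁻¹ : ℝ) : ℂ) • 1 := by
    ext1 Y
    simp only [LinearMap.add_apply, LinearMap.sub_apply, LinearMap.smul_apply, conjugation_apply,
      lindbladian_apply, Module.End.one_apply, Matrix.conjTranspose_sub,
      Matrix.conjTranspose_smul, Matrix.conjTranspose_one, hGG, Complex.star_def,
      Complex.conj_ofReal]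
    have h1 : (1 / 2 : ℂ) • (Lᴴ * L * Y + Y * (Lᴴ * L)) = G * Y + Y * G := by
      rw [hG, smul_add, Matrix.smul_mul, Matrix.mul_smul]
    rw [h1]
    simp only [Matrix.sub_mul, Matrix.mul_sub, Matrix.smul_mul, Matrix.mul_smul, Matrix.one_mul,
      Matrix.mul_one, smul_smul, hrs, smul_sub]
    push_cast
    rw [mul_inv_cancel₀ hrc, inv_mul_cancel₀ hrc]
    match_scalars <;> field_simp
    ring
  change (semigroup (lindbladian L + (s : ℂ) • conjugation G) t X).PosSemidef
  rw [key, semigroup_sub_smul_one]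
  refine Matrix.PosSemidef.smul (IsPositive.semigroup
    ((isPositive_conjugation L).add (isPositive_conjugation _)) ht X hX) ?_
  exact Complex.zero_le_real.2 (Real.exp_pos _).le

/-! ### Trace preservation -/

theorem trace_tsum {f : ℕ → Op m} (hf : Summable f) :
    (∑' j, f j).trace = ∑' j, (f j).trace :=
  ((hf.hasSum.map (Matrix.traceAddMonoidHom m ℂ) (continuous_id.matrix_trace)).tsum_eq).symm

theorem summable_trace {f : ℕ → Op m} (hf : Summable f) : Summable fun j => (f j).trace :=
  (hf.hasSum.map (Matrix.traceAddMonoidHom m ℂ) (continuous_id.matrix_trace)).summable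

theorem trace_lindbladian (L X : Op m) : (lindbladian L X).trace = 0 := by
  rw [lindbladian_apply, Matrix.trace_sub, Matrix.trace_smul, Matrix.trace_add,
    Matrix.trace_mul_comm (L * X), Matrix.trace_mul_comm X, ← Matrix.mul_assoc, ← two_mul,
    smul_eq_mul, ← mul_assoc]
  norm_num

/-- Every term of the series beyond the zeroth lies in the range of `D_L`, which is traceless. -/
theorem trace_semigroup_lindbladian (L : Op m) (t : ℝ) (X : Op m) :
    (semigroup (lindbladian L) t X).trace = X.trace := by
  change (∑' j : ℕ, ((t : ℂ) ^ j / (j ! : ℂ)) • (lindbladian L ^ j) X).trace = _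
  rw [trace_tsum (summable_semigroup _ t X), tsum_eq_single 0]
  · simp
  · intro j hj
    obtain ⟨j, rfl⟩ := Nat.exists_eq_succ_of_ne_zero hj
    rw [Matrix.trace_smul, pow_succ' (lindbladian L), Module.End.mul_apply, trace_lindbladian, smul_zero]

/-! ### Domination and the second-order remainder -/

/-- `X` is dominated with weight `c` if `-F ≤ X ≤ F` for some `F` of trace at most `c`. -/
def Dominated (X : Op m) (c : ℝ) : Prop :=
  ∃ F : Op m, (F + X).PosSemidef ∧ (F - X).PosSemidef ∧ F.trace.re ≤ c

theorem Dominated.add {X Y : Op m} {c e : ℝ} (hX : Dominated X c) (hY : Dominated Y e) :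
    Dominated (X + Y) (c + e) := by
  obtain ⟨F, h1, h2, h3⟩ := hX
  obtain ⟨G, g1, g2, g3⟩ := hY
  refine ⟨F + G, ?_, ?_, ?_⟩
  · rw [add_add_add_comm]; exact h1.add g1
  · rw [add_sub_add_comm]; exact h2.add g2
  · rw [Matrix.trace_add, Complex.add_re]; exact add_le_add h3 g3

theorem Dominated.neg {X : Op m} {c : ℝ} (hX : Dominated X c) : Dominated (-X) c := by
  obtain ⟨F, h1, h2, h3⟩ := hX
  exact ⟨F, by rwa [← sub_eq_add_neg], by rwa [sub_neg_eq_add], h3⟩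

theorem Dominated.sub {X Y : Op m} {c e : ℝ} (hX : Dominated X c) (hY : Dominated Y e) :
    Dominated (X - Y) (c + e) := by
  rw [sub_eq_add_neg]
  exact hX.add hY.neg

theorem Dominated.mono {X : Op m} {c e : ℝ} (hX : Dominated X c) (h : c ≤ e) : Dominated X e := by
  obtain ⟨F, h1, h2, h3⟩ := hX
  exact ⟨F, h1, h2, h3.trans h⟩

theorem dominated_zero : Dominated (0 : Op m) 0 :=
  ⟨0, by simpa using Matrix.PosSemidef.zero, by simpa using Matrix.PosSemidef.zero, by simp⟩

theorem dominated_of_posSemidef {X : Op m} (hX : X.PosSemidef) : Dominated X X.trace.re :=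
  ⟨X, hX.add hX, by rw [sub_self]; exact Matrix.PosSemidef.zero, le_rfl⟩

/-- This plays the role of trace-norm contractivity: the witness `F` is mapped along with `X`. -/
theorem Dominated.map {X : Op m} {c : ℝ} (hX : Dominated X c) {N : SuperOp m k}
    (hN : IsPositive N) (ht : ∀ Y, (N Y).trace = Y.trace) : Dominated (N X) c := by
  obtain ⟨F, h1, h2, h3⟩ := hX
  refine ⟨N F, ?_, ?_, by rwa [ht]⟩
  · rw [← map_add]; exact hN _ h1
  · rw [← map_sub]; exact hN _ h2

theorem Dominated.schattenNorm_le [DecidableEq m] {X : Op m} {c : ℝ} (hX : Dominated X c) :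
    schattenNorm 1 X ≤ c := by
  obtain ⟨F, h1, h2, h3⟩ := hX
  exact (schattenNorm_one_le_trace h1 h2).trans h3

/-- The part of order at least two of the exponential series. -/
noncomputable def semigroupTail (K : SuperOp m m) (t : ℝ) (X : Op m) : Op m :=
  ∑' j : ℕ, ((t : ℂ) ^ (j + 2) / ((j + 2)! : ℂ)) • (K ^ (j + 2)) X

theorem semigroup_eq_add_semigroupTail (K : SuperOp m m) (t : ℝ) (X : Op m) :
    semigroup K t X = X + (t : ℂ) • K X + semigroupTail K t X := by
  have h := (summable_semigroup K t X).sum_add_tsum_nat_add 2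
  simp only [Finset.sum_range_succ, Finset.sum_range_zero, zero_add, pow_zero, pow_one,
    Nat.factorial_zero, Nat.factorial_one, Nat.cast_one, div_one, one_smul,
    Module.End.one_apply] at h
  exact h.symm

section Tail

variable {P N : SuperOp m m}

omit [Fintype m] in
-- The two bounds must be carried through the induction together, because `(P + N)U ± (P - N)V = P(U
-- ± V) + N(U ∓ V)`.
theorem posSemidef_pow_add_sub (hP : IsPositive P) (hN : IsPositive N) {X : Op m}
    (hX : X.PosSemidef) (j : ℕ) :
    (((P + N) ^ j) X + ((P - N) ^ j) X).PosSemidef ∧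
      (((P + N) ^ j) X - ((P - N) ^ j) X).PosSemidef := by
  induction j with
  | zero =>
    simp only [pow_zero, Module.End.one_apply, sub_self]
    exact ⟨hX.add hX, Matrix.PosSemidef.zero⟩
  | succ j ih =>
    rw [pow_succ', pow_succ', Module.End.mul_apply, Module.End.mul_apply]
    set U := ((P + N) ^ j) X
    set V := ((P - N) ^ j) X
    have h1 := (hP _ ih.1).add (hN _ ih.2)
    have h2 := (hP _ ih.2).add (hN _ ih.1)
    constructor
    · convert h1 using 1
      simp only [LinearMap.add_apply, LinearMap.sub_apply, map_add, map_sub]; abel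
    · convert h2 using 1
      simp only [LinearMap.add_apply, LinearMap.sub_apply, map_add, map_sub]; abel

theorem trace_pow_le {F : SuperOp m m} (hF : IsPositive F) {κ : ℝ} (hκ : 0 ≤ κ)
    (htr : ∀ X : Op m, X.PosSemidef → (F X).trace.re ≤ κ * X.trace.re) {X : Op m}
    (hX : X.PosSemidef) (j : ℕ) : ((F ^ j) X).trace.re ≤ κ ^ j * X.trace.re := by
  induction j with
  | zero => simp
  | succ j ih =>
    rw [pow_succ', pow_succ', Module.End.mul_apply, mul_assoc]
    exact (htr _ (hF.pow j X hX)).trans (mul_le_mul_of_nonneg_left ih hκ)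

/-- The witness is the same tail with `P + N` in place of `P - N`. For `t ≤ 1` one has
`t^{j+2}/(j+2)! ≤ t²/j!`, which extracts `t²` and leaves the series of `κ² e^κ`. -/
theorem dominated_semigroupTail (hP : IsPositive P) (hN : IsPositive N) {κ : ℝ} (hκ : 0 ≤ κ)
    (htr : ∀ X : Op m, X.PosSemidef → ((P + N) X).trace.re ≤ κ * X.trace.re)
    {t : ℝ} (ht : 0 ≤ t) (ht1 : t ≤ 1) {X : Op m} (hX : X.PosSemidef) :
    Dominated (semigroupTail (P - N) t X)
      (t ^ 2 * (κ ^ 2 * ∑' j : ℕ, κ ^ j / (j ! : ℝ)) * X.trace.re) := by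
  have hs : ∀ K : SuperOp m m,
      Summable fun j : ℕ => ((t : ℂ) ^ (j + 2) / ((j + 2)! : ℂ)) • (K ^ (j + 2)) X :=
    fun K => (summable_nat_add_iff (f := fun j : ℕ => ((t : ℂ) ^ j / (j ! : ℂ)) • (K ^ j) X) 2).2
      (summable_semigroup K t X)
  have hc : ∀ j : ℕ, (0 : ℂ) ≤ (t : ℂ) ^ (j + 2) / ((j + 2)! : ℂ) :=
    fun j => pow_div_factorial_nonneg ht (j + 2)
  refine ⟨semigroupTail (P + N) t X, ?_, ?_, ?_⟩
  · unfold semigroupTail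
    rw [← (hs _).tsum_add (hs _)]
    refine posSemidef_tsum ((hs _).add (hs _)) fun j => ?_
    rw [← smul_add]
    exact (posSemidef_pow_add_sub hP hN hX (j + 2)).1.smul (hc j)
  · unfold semigroupTail
    rw [← (hs _).tsum_sub (hs _)]
    refine posSemidef_tsum ((hs _).sub (hs _)) fun j => ?_
    rw [← smul_sub]
    exact (posSemidef_pow_add_sub hP hN hX (j + 2)).2.smul (hc j)
  · unfold semigroupTail
    rw [trace_tsum (hs _), Complex.re_tsum (summable_trace (hs _)), ← tsum_mul_left,
      ← tsum_mul_left, ← tsum_mul_right]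
    refine Summable.tsum_le_tsum (fun j => ?_)
      (Complex.hasSum_re (summable_trace (hs _)).hasSum).summable
      ((((Real.summable_pow_div_factorial κ).mul_left _).mul_left _).mul_right _)
    have hcast : ((t : ℂ) ^ (j + 2) / ((j + 2)! : ℂ)) = ((t ^ (j + 2) / ((j + 2)! : ℝ) : ℝ) : ℂ) := by
      push_cast; rfl
    rw [Matrix.trace_smul, hcast, smul_eq_mul, Complex.re_ofReal_mul]
    have hX0 : 0 ≤ X.trace.re := (Complex.le_def.1 hX.trace_nonneg).1
    have h1 : t ^ (j + 2) ≤ t ^ 2 := pow_le_pow_of_le_one ht ht1 (by lia)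
    have h2 : (j ! : ℝ) ≤ ((j + 2)! : ℝ) := Nat.cast_le.2 (Nat.factorial_le (by lia))
    have h3 : t ^ (j + 2) / ((j + 2)! : ℝ) ≤ t ^ 2 / (j ! : ℝ) :=
      div_le_div₀ (by positivity) h1 (by positivity) h2
    calc t ^ (j + 2) / ((j + 2)! : ℝ) * (((P + N) ^ (j + 2)) X).trace.re
        ≤ t ^ (j + 2) / ((j + 2)! : ℝ) * (κ ^ (j + 2) * X.trace.re) :=
          mul_le_mul_of_nonneg_left (trace_pow_le (hP.add hN) hκ htr hX _) (by positivity)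
      _ ≤ t ^ 2 / (j ! : ℝ) * (κ ^ (j + 2) * X.trace.re) :=
          mul_le_mul_of_nonneg_right h3 (by positivity)
      _ = t ^ 2 * (κ ^ 2 * (κ ^ j / (j ! : ℝ))) * X.trace.re := by ring

end Tail

/-- The constant in the second-order estimate for the semigroup of a Lindbladian whose Lindblad
operator has squared operator norm at most `c`. -/
noncomputable def tailConst (c : ℝ) : ℝ :=
  ((1 + c) ^ 2) ^ 2 * ∑' j : ℕ, ((1 + c) ^ 2) ^ j / (j ! : ℝ)

theorem tailConst_nonneg (c : ℝ) : 0 ≤ tailConst c :=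
  mul_nonneg (by positivity) (tsum_nonneg fun j => by positivity)

theorem trace_conjugation_le [DecidableEq m] {L : Op m} {c : ℝ}
    (h : ((c : ℂ) • (1 : Op m) - Lᴴ * L).PosSemidef) {X : Op m} (hX : X.PosSemidef) :
    (L * X * Lᴴ).trace.re ≤ c * X.trace.re := by
  have h1 := (Complex.le_def.1 (trace_mul_nonneg h hX)).1
  rw [Matrix.sub_mul, Matrix.trace_sub, Matrix.smul_mul, Matrix.one_mul, Matrix.trace_smul,
    smul_eq_mul, Complex.sub_re, Complex.re_ofReal_mul, Complex.zero_re, sub_nonneg] at h1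
  rwa [Matrix.trace_mul_comm, ← Matrix.mul_assoc]

/-- With `H = L†L`, the anticommutator is polarized as `HY + YH = (1+H)Y(1+H) - Y - HYH`, which
exhibits `D_L` as `P - N`. Then `Tr (P + N)Y = Tr Y + 2 Tr LYL† + Tr HYH`, and the factors `1`,
`2c`, `c²` add up to `κ = (1 + c)²`. -/
theorem dominated_semigroupTail_lindbladian [DecidableEq m] {L : Op m} {c : ℝ} (hc : 0 ≤ c)
    (h₁ : ((c : ℂ) • (1 : Op m) - Lᴴ * L).PosSemidef)
    (h₂ : ((c : ℂ) • (1 : Op m) - L * Lᴴ).PosSemidef)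
    {t : ℝ} (ht : 0 ≤ t) (ht1 : t ≤ 1) {X : Op m} (hX : X.PosSemidef) :
    Dominated (semigroupTail (lindbladian L) t X) (t ^ 2 * tailConst c * X.trace.re) := by
  set H : Op m := Lᴴ * L with hH
  have hHH : Hᴴ = H := by simp [hH]
  have hhalf : (0 : ℂ) ≤ 1 / 2 := by positivity
  set P : SuperOp m m := conjugation L + (1 / 2 : ℂ) • (conjugation 1 + conjugation H) with hPdef
  set N : SuperOp m m := (1 / 2 : ℂ) • conjugation (1 + H) with hNdef
  have hP : IsPositive P := (isPositive_conjugation _).add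
    (((isPositive_conjugation _).add (isPositive_conjugation _)).smul hhalf)
  have hN : IsPositive N := (isPositive_conjugation _).smul hhalf
  have hPN : lindbladian L = P - N := by
    ext1 Y
    simp only [hPdef, hNdef, LinearMap.add_apply, LinearMap.sub_apply, LinearMap.smul_apply,
      conjugation_apply, lindbladian_apply, Matrix.conjTranspose_add, Matrix.conjTranspose_one,
      hHH, Matrix.add_mul, Matrix.mul_add, Matrix.one_mul, Matrix.mul_one, ← hH]
    module
  rw [hPN]
  refine dominated_semigroupTail hP hN (by positivity) (fun Y hY => ?_) ht ht1 hX
  have hsum : ((P + N) Y).trace = Y.trace + 2 * (L * Y * Lᴴ).trace + (H * Y * H).trace := by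
    have e : (L * Y * Lᴴ).trace = (H * Y).trace := by
      rw [Matrix.trace_mul_comm, ← Matrix.mul_assoc]
    simp only [hPdef, hNdef, LinearMap.add_apply, LinearMap.smul_apply,
      conjugation_apply, Matrix.conjTranspose_add, Matrix.conjTranspose_one,
      hHH, Matrix.add_mul, Matrix.mul_add, Matrix.one_mul, Matrix.mul_one, Matrix.trace_add,
      Matrix.trace_smul, e, Matrix.trace_mul_comm Y H, smul_eq_mul]
    ring
  have b1 := trace_conjugation_le h₁ hY
  have b2 : (H * Y * H).trace.re ≤ c * (c * Y.trace.re) := by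
    -- `HYH` is conjugation by `L` followed by conjugation by `L†`; the second one needs `LL† ≤ c`.
    have h := trace_conjugation_le (L := Lᴴ) (X := L * Y * Lᴴ) (c := c)
      (by rwa [Matrix.conjTranspose_conjTranspose]) (hY.mul_mul_conjTranspose_same L)
    have e : H * Y * H = Lᴴ * (L * Y * Lᴴ) * Lᴴᴴ := by
      simp only [hH, Matrix.mul_assoc, Matrix.conjTranspose_conjTranspose]
    rw [e]
    exact h.trans (mul_le_mul_of_nonneg_left b1 hc)
  have h2re : (2 * (L * Y * Lᴴ).trace).re = 2 * (L * Y * Lᴴ).trace.re := by simp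
  rw [hsum, Complex.add_re, Complex.add_re, h2re]
  nlinarith

/-! ### Ampliation by a reference system -/

section Ampliation

variable {R m k l : Type*}

/-- The ampliation `I_R ⊗ N` as a superoperator. -/
def ampliateMap (R : Type*) {m k : Type*} (N : SuperOp m k) : SuperOp (R × m) (R × k) where
  toFun := ampliate N
  map_add' X Y := by
    ext a b
    exact congrFun (congrFun (N.map_add (Matrix.of fun i j => X (a.1, i) (b.1, j))
      (Matrix.of fun i j => Y (a.1, i) (b.1, j))) a.2) b.2
  map_smul' c X := by
    ext a b
    exact congrFun (congrFun (N.map_smul c (Matrix.of fun i j => X (a.1, i) (b.1, j))) a.2) b.2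

theorem ampliateMap_comp (N₁ : SuperOp k l) (N₂ : SuperOp m k) (X : Op (R × m)) :
    ampliateMap R (N₁ ∘ₗ N₂) X = ampliateMap R N₁ (ampliateMap R N₂ X) := rfl

theorem ampliateMap_pow (N : SuperOp m m) (j : ℕ) :
    ampliateMap R (N ^ j) = ampliateMap R N ^ j := by
  induction j with
  | zero => rfl
  | succ j ih => rw [pow_succ', pow_succ', ← ih]; rfl

theorem tsum_matrix_apply {f : ℕ → Op m} (hf : Summable f) (a b : m) :
    (∑' j, f j) a b = ∑' j, f j a b :=
  ((hf.hasSum.map (Matrix.entryAddMonoidHom ℂ a b) (continuous_id.matrix_elem a b)).tsum_eq).symm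

variable [Fintype R] [Fintype m] [Fintype k]

theorem ampliateMap_semigroup (K : SuperOp m m) (t : ℝ) :
    ampliateMap R (semigroup K t) = semigroup (ampliateMap R K) t := by
  refine LinearMap.ext fun X => ?_
  ext a b
  change (∑' j : ℕ, ((t : ℂ) ^ j / (j ! : ℂ)) • (K ^ j) _) a.2 b.2 =
    (∑' j : ℕ, ((t : ℂ) ^ j / (j ! : ℂ)) • (ampliateMap R K ^ j) X) a b
  rw [tsum_matrix_apply (summable_semigroup K t _),
    tsum_matrix_apply (summable_semigroup (ampliateMap R K) t X)]
  refine tsum_congr fun j => ?_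
  rw [← ampliateMap_pow]
  rfl

/-- Ampliated Lindblad semigroups are again Lindblad semigroups, so positivity upgrades to complete
positivity and the remainder estimate applies with a reference present. -/
theorem ampliateMap_lindbladian [DecidableEq R] (L : Op m) :
    ampliateMap R (lindbladian L) = lindbladian ((1 : Op R) ⊗ₖ L) := by
  have hl : ∀ (A : Op m) (X : Op (R × m)) (r s : R),
      (Matrix.of fun i j => (((1 : Op R) ⊗ₖ A) * X) (r, i) (s, j)) =
        A * Matrix.of fun i j => X (r, i) (s, j) := fun A X r s => by
    ext i j
    simp [Matrix.mul_apply, Fintype.sum_prod_type, Matrix.one_apply]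
  have hr : ∀ (A : Op m) (X : Op (R × m)) (r s : R),
      (Matrix.of fun i j => (X * ((1 : Op R) ⊗ₖ A)) (r, i) (s, j)) =
        (Matrix.of fun i j => X (r, i) (s, j)) * A := fun A X r s => by
    ext i j
    simp [Matrix.mul_apply, Fintype.sum_prod_type, Matrix.one_apply]
  refine LinearMap.ext fun X => ?_
  ext a b
  rw [lindbladian_apply, Matrix.conjTranspose_kronecker, Matrix.conjTranspose_one,
    ← Matrix.mul_kronecker_mul, Matrix.one_mul]
  have h1 := congrFun (congrFun (hr Lᴴ (((1 : Op R) ⊗ₖ L) * X) a.1 b.1) a.2) b.2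
  have h2 := congrFun (congrFun (hl (Lᴴ * L) X a.1 b.1) a.2) b.2
  have h3 := congrFun (congrFun (hr (Lᴴ * L) X a.1 b.1) a.2) b.2
  rw [hl] at h1
  simp only [Matrix.of_apply, Prod.mk.eta] at h1 h2 h3
  rw [Matrix.sub_apply, Matrix.smul_apply, Matrix.add_apply, h1, h2, h3]
  rfl

theorem trace_ampliateMap {N : SuperOp m k} (h : ∀ X, (N X).trace = X.trace) (X : Op (R × m)) :
    (ampliateMap R N X).trace = X.trace := by
  simp only [Matrix.trace, Matrix.diag_apply, Fintype.sum_prod_type]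
  exact Finset.sum_congr rfl fun r _ => h (Matrix.of fun i j => X (r, i) (r, j))

end Ampliation

/-! ### Quantum channels and accumulation of errors -/

/-- A quantum channel: a completely positive and trace-preserving superoperator. -/
structure IsChannel {m k : Type*} [Fintype m] [Fintype k] (N : SuperOp m k) : Prop where
  isPositive : ∀ r : ℕ, IsPositive (ampliateMap (Fin r) N)
  trace_eq : ∀ X, (N X).trace = X.trace

namespace IsChannel

variable {m k l : Type*} [Fintype m] [Fintype k] [Fintype l]

theorem comp {N₁ : SuperOp k l} {N₂ : SuperOp m k} (h₁ : IsChannel N₁) (h₂ : IsChannel N₂) :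
    IsChannel (N₁ ∘ₗ N₂) where
  isPositive r X hX := h₁.isPositive r _ (h₂.isPositive r X hX)
  trace_eq X := (h₁.trace_eq _).trans (h₂.trace_eq X)

theorem pow {N : SuperOp m m} (h : IsChannel N) (n : ℕ) : IsChannel (N ^ n) := by
  induction n with
  | zero => exact ⟨fun r X hX => hX, fun X => rfl⟩
  | succ n ih => rw [pow_succ']; exact h.comp ih

theorem isState {N : SuperOp m k} (h : IsChannel N) {r : ℕ} {ρ : Op (Fin r × m)}
    (hρ : IsState ρ) : IsState (ampliateMap (Fin r) N ρ) :=
  ⟨h.isPositive r ρ hρ.1, (trace_ampliateMap h.trace_eq ρ).trans hρ.2⟩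

theorem dominated_sub {N₁ N₂ : SuperOp m k} (h₁ : IsChannel N₁) (h₂ : IsChannel N₂) {r : ℕ}
    {ρ : Op (Fin r × m)} (hρ : IsState ρ) :
    Dominated (ampliateMap (Fin r) N₁ ρ - ampliateMap (Fin r) N₂ ρ) 2 := by
  have s₁ := h₁.isState hρ
  have s₂ := h₂.isState hρ
  refine ((dominated_of_posSemidef s₁.1).sub (dominated_of_posSemidef s₂.1)).mono ?_
  rw [s₁.2, s₂.2]
  norm_num

/-- Errors of channels that are close on all states add up linearly under composition. -/
theorem dominated_pow_sub_pow {N₁ N₂ : SuperOp m m} (h₁ : IsChannel N₁) (h₂ : IsChannel N₂)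
    {r : ℕ} {c : ℝ}
    (h : ∀ ρ : Op (Fin r × m), IsState ρ →
      Dominated (ampliateMap (Fin r) N₁ ρ - ampliateMap (Fin r) N₂ ρ) c)
    {ρ : Op (Fin r × m)} (hρ : IsState ρ) (n : ℕ) :
    Dominated (ampliateMap (Fin r) (N₁ ^ n) ρ - ampliateMap (Fin r) (N₂ ^ n) ρ) (n * c) := by
  induction n with
  | zero => simpa using dominated_zero
  | succ n ih =>
    -- Telescoping: `N₁^{n+1} - N₂^{n+1} = N₁(N₁^n - N₂^n) + (N₁ - N₂)N₂^n`. The channel `N₁`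
    -- preserves the bound on the first term, and `N₂^n ρ` is a state, so `h` bounds the second.
    have e : ampliateMap (Fin r) (N₁ ^ (n + 1)) ρ - ampliateMap (Fin r) (N₂ ^ (n + 1)) ρ =
        ampliateMap (Fin r) N₁
          (ampliateMap (Fin r) (N₁ ^ n) ρ - ampliateMap (Fin r) (N₂ ^ n) ρ) +
        (ampliateMap (Fin r) N₁ (ampliateMap (Fin r) (N₂ ^ n) ρ) -
          ampliateMap (Fin r) N₂ (ampliateMap (Fin r) (N₂ ^ n) ρ)) := by
      rw [map_sub, pow_succ', pow_succ']
      exact (sub_add_sub_cancel _ _ _).symm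
    rw [e]
    refine ((ih.map (h₁.isPositive r) (trace_ampliateMap h₁.trace_eq)).add
      (h _ ((h₂.pow n).isState hρ))).mono (le_of_eq ?_)
    push_cast
    ring

end IsChannel

/-! ### The channels that make up a step, and uniform constants -/

section Channels

variable {m k : Type*} [Fintype m] [Fintype k]

theorem isChannel_semigroup_lindbladian (L : Op m) {t : ℝ} (ht : 0 ≤ t) :
    IsChannel (semigroup (lindbladian L) t) where
  isPositive r := by
    rw [ampliateMap_semigroup, ampliateMap_lindbladian]
    exact isPositive_semigroup_lindbladian _ ht
  trace_eq := trace_semigroup_lindbladian L t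

theorem isChannel_partialTrace : IsChannel (partialTrace : SuperOp (m × k) m) where
  isPositive r X hX := by
    have h : ampliateMap (Fin r) (partialTrace : SuperOp (m × k) m) X =
        ∑ a : k, X.submatrix (fun x : Fin r × m => (x.1, (x.2, a)))
          (fun x : Fin r × m => (x.1, (x.2, a))) := by
      ext x y
      rw [Matrix.sum_apply]
      rfl
    rw [h]
    exact Matrix.posSemidef_sum _ fun a _ => hX.submatrix _
  trace_eq X := by
    simp only [Matrix.trace, Matrix.diag_apply, Fintype.sum_prod_type]
    rfl

theorem isChannel_append {σ : Op k} (hσ : IsState σ) :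
    IsChannel (append σ : SuperOp m (m × k)) where
  isPositive r X hX :=
    (hX.kronecker hσ.1).submatrix (Equiv.prodAssoc (Fin r) m k).symm
  trace_eq X := by
    change (X ⊗ₖ σ).trace = _
    rw [Matrix.trace_kronecker, hσ.2, mul_one]

theorem isChannel_step {d : ℕ} {Δ : ℝ} (hΔ : 0 ≤ Δ) {σ : Op (Fin d × Fin d)} (hσ : IsState σ) :
    IsChannel (step Δ σ) :=
  isChannel_partialTrace.comp ((isChannel_semigroup_lindbladian _ hΔ).comp (isChannel_append hσ))

omit [Fintype m] in
theorem partialTrace_append {σ : Op k} (hσ : IsState σ) (ρ : Op m) :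
    partialTrace (append σ ρ) = ρ := by
  ext i j
  change ∑ a, ρ i j * σ a a = _
  rw [← Finset.mul_sum]
  exact (congrArg (ρ i j * ·) hσ.2).trans (mul_one _)

/-- Each eigenvalue is at most the sum of all, as none is negative. The trace thus serves as a crude
bound on the operator norm. -/
theorem posSemidef_trace_smul_one_sub [DecidableEq m] {H : Op m} (hH : H.PosSemidef) :
    ((H.trace.re : ℂ) • (1 : Op m) - H).PosSemidef := by
  set U : Op m := hH.1.eigenvectorUnitary.1 with hU
  have hUU' : U * star U = 1 := Unitary.coe_mul_star_self hH.1.eigenvectorUnitary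
  have hs : H = U * Matrix.diagonal (RCLike.ofReal ∘ hH.1.eigenvalues) * star U := by
    conv_lhs => rw [hH.1.spectral_theorem, Unitary.conjStarAlgAut_apply]
  have h : (H.trace.re : ℂ) • (1 : Op m) - H =
      U * Matrix.diagonal (fun i => (((∑ j, hH.1.eigenvalues j) - hH.1.eigenvalues i : ℝ) : ℂ)) *
        Uᴴ := by
    have hd : Matrix.diagonal
        (fun i => (((∑ j, hH.1.eigenvalues j) - hH.1.eigenvalues i : ℝ) : ℂ)) =
        (H.trace.re : ℂ) • (1 : Op m) - Matrix.diagonal (RCLike.ofReal ∘ hH.1.eigenvalues) := by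
      rw [hH.1.trace_eq_sum_eigenvalues]
      ext i j
      by_cases hij : i = j
      · subst hij; simp
      · simp [hij]
    rw [hd, Matrix.mul_sub, Matrix.sub_mul, ← Matrix.star_eq_conjTranspose, ← hs,
      Matrix.mul_smul, Matrix.mul_one, Matrix.smul_mul, hUU']
  rw [h]
  refine (Matrix.PosSemidef.diagonal fun i => ?_).mul_mul_conjTranspose_same U
  refine Complex.zero_le_real.2 (sub_nonneg.2 ?_)
  exact Finset.single_le_sum (f := hH.1.eigenvalues) (fun j _ => hH.eigenvalues_nonneg j)
    (Finset.mem_univ i)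

/-- The second-order estimate for the semigroup of an ampliated Lindbladian is uniform in the
reference system. -/
theorem dominated_semigroupTail_ampliateMap [DecidableEq m] (L : Op m) (r : ℕ) {t : ℝ}
    (ht : 0 ≤ t) (ht1 : t ≤ 1) {X : Op (Fin r × m)} (hX : X.PosSemidef) :
    Dominated (semigroupTail (ampliateMap (Fin r) (lindbladian L)) t X)
      (t ^ 2 * tailConst (Lᴴ * L).trace.re * X.trace.re) := by
  -- The bound `H ≤ Tr H` is taken before tensoring with the identity; the trace of `1 ⊗ H` itself
  -- would grow with `r`.
  have key : ∀ H : Op m, H.PosSemidef →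
      ((H.trace.re : ℂ) • (1 : Op (Fin r × m)) - (1 : Op (Fin r)) ⊗ₖ H).PosSemidef := fun H hH => by
    have h := (Matrix.PosSemidef.one (n := Fin r) (R := ℂ)).kronecker
      (posSemidef_trace_smul_one_sub hH)
    have e : (1 : Op (Fin r)) ⊗ₖ ((H.trace.re : ℂ) • (1 : Op m) - H) =
        (H.trace.re : ℂ) • (1 : Op (Fin r × m)) - (1 : Op (Fin r)) ⊗ₖ H := by
      rw [eq_sub_iff_add_eq, ← Matrix.kronecker_add, sub_add_cancel, Matrix.kronecker_smul,
        Matrix.one_kronecker_one]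
    rwa [e] at h
  rw [ampliateMap_lindbladian]
  refine dominated_semigroupTail_lindbladian ?_ ?_ ?_ ht ht1 hX
  · exact (Complex.le_def.1 (Matrix.posSemidef_conjTranspose_mul_self L).trace_nonneg).1
  · rw [Matrix.conjTranspose_kronecker, Matrix.conjTranspose_one, ← Matrix.mul_kronecker_mul,
      Matrix.one_mul]
    exact key _ (Matrix.posSemidef_conjTranspose_mul_self L)
  · rw [Matrix.conjTranspose_kronecker, Matrix.conjTranspose_one, ← Matrix.mul_kronecker_mul,
      Matrix.one_mul, Matrix.trace_mul_comm]
    exact key _ (Matrix.posSemidef_self_mul_conjTranspose L)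

end Channels

/-! ### The first-order identity -/

section FirstOrder

variable {d : ℕ}

/-- The isometry up to normalization that appends `|Γ⟩`. -/
def appendMaxEnt (d : ℕ) : Matrix (Fin d × (Fin d × Fin d)) (Fin d) ℂ :=
  Matrix.of fun x a => (if x.1 = a then 1 else 0) * (if x.2.1 = x.2.2 then 1 else 0)

/-- The contraction `⟨Γ|_{SQ}`, which leaves the register `P`. -/
def contractMaxEnt (d : ℕ) : Matrix (Fin d) (Fin d × (Fin d × Fin d)) ℂ :=
  Matrix.of fun a x => (if x.2.1 = a then 1 else 0) * (if x.1 = x.2.2 then 1 else 0)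

theorem maxEnt_apply (x : Fin d × Fin d) : maxEnt d x = if x.1 = x.2 then 1 else 0 := by
  obtain ⟨p, q⟩ := x
  simp only [maxEnt, Finset.sum_apply, Pi.single_apply, Prod.mk.injEq]
  by_cases h : p = q
  · subst h; simp
  · rw [if_neg h]
    refine Finset.sum_eq_zero fun i _ => if_neg ?_
    rintro ⟨rfl, rfl⟩
    exact h rfl

theorem swapOp_apply (x y : Fin d × Fin d) :
    swapOp d x y = (if y.2 = x.1 then 1 else 0) * (if x.2 = y.1 then 1 else 0) := by
  simp only [swapOp, Matrix.sum_apply, Matrix.kroneckerMap_apply, Matrix.single_apply, ite_and,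
    mul_ite, mul_one, mul_zero, Finset.sum_ite_eq', Finset.mem_univ, if_true]
  by_cases h1 : y.2 = x.1 <;> by_cases h2 : x.2 = y.1 <;> simp [h1, h2]

/-- After the swap, `⟨Γ|_{PQ}` becomes `⟨Γ|_{SQ}`. So `M` factors through `ℂ^d`: contract `S` with
`Q`, take the remaining `P` as the new system, and adjoin a fresh `|Γ⟩`. -/
theorem fixedLindbladOp_eq (d : ℕ) :
    fixedLindbladOp d = ((1 / Real.sqrt d : ℝ) : ℂ) • (appendMaxEnt d * contractMaxEnt d) := by
  unfold fixedLindbladOp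
  congr 1
  ext ⟨s, p, q⟩ ⟨s', p', q'⟩
  simp only [Matrix.mul_apply, Fintype.sum_prod_type, Matrix.kroneckerMap_apply, ketbra,
    Matrix.vecMulVec_apply, maxEnt_apply, Pi.star_apply, Matrix.reindex_apply,
    Matrix.submatrix_apply, swapOp_apply, Matrix.one_apply, appendMaxEnt, contractMaxEnt,
    Matrix.of_apply, Equiv.prodAssoc_symm_apply]
  simp

theorem contractMaxEnt_mul {n : Type*} (Y : Matrix (Fin d × (Fin d × Fin d)) n ℂ) (a : Fin d)
    (c : n) : (contractMaxEnt d * Y) a c = ∑ s, Y (s, (a, s)) c := by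
  simp [Matrix.mul_apply, Fintype.sum_prod_type, contractMaxEnt]

theorem mul_conjTranspose_contractMaxEnt {n : Type*} (Y : Matrix n (Fin d × (Fin d × Fin d)) ℂ)
    (c : n) (a : Fin d) : (Y * (contractMaxEnt d)ᴴ) c a = ∑ s, Y c (s, (a, s)) := by
  simp [Matrix.mul_apply, Fintype.sum_prod_type, contractMaxEnt, apply_ite (starRingEnd ℂ)]

theorem conjTranspose_contractMaxEnt_mul {n : Type*} (Y : Matrix (Fin d) n ℂ)
    (x : Fin d × (Fin d × Fin d)) (c : n) :
    ((contractMaxEnt d)ᴴ * Y) x c = if x.1 = x.2.2 then Y x.2.1 c else 0 := by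
  simp [Matrix.mul_apply, contractMaxEnt, apply_ite (starRingEnd ℂ)]

theorem mul_contractMaxEnt {n : Type*} (Y : Matrix n (Fin d) ℂ) (c : n)
    (x : Fin d × (Fin d × Fin d)) :
    (Y * contractMaxEnt d) c x = if x.1 = x.2.2 then Y c x.2.1 else 0 := by
  simp [Matrix.mul_apply, contractMaxEnt]

theorem conjTranspose_appendMaxEnt_mul_self (d : ℕ) :
    (appendMaxEnt d)ᴴ * appendMaxEnt d = (d : ℂ) • 1 := by
  ext a b
  by_cases h : b = a
  · simp [Matrix.mul_apply, Fintype.sum_prod_type, appendMaxEnt, h]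
  · simp [Matrix.mul_apply, Fintype.sum_prod_type, appendMaxEnt, h, Ne.symm h]

theorem partialTrace_appendMaxEnt (X : Op (Fin d)) :
    partialTrace (appendMaxEnt d * X * (appendMaxEnt d)ᴴ) = (d : ℂ) • X := by
  ext i j
  change ∑ x, (appendMaxEnt d * X * (appendMaxEnt d)ᴴ) (i, x) (j, x) = _
  simp [Matrix.mul_apply, Fintype.sum_prod_type, appendMaxEnt]

theorem programState_apply (L : Op (Fin d)) (x y : Fin d × Fin d) :
    programState L x y = L x.1 x.2 * star (L y.1 y.2) := by
  have h : ∀ x : Fin d × Fin d, ((L ⊗ₖ (1 : Op (Fin d))) *ᵥ maxEnt d) x = L x.1 x.2 := fun x => by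
    simp [Matrix.mulVec, dotProduct, Fintype.sum_prod_type, maxEnt_apply, Matrix.one_apply]
  rw [programState, ketbra, Matrix.vecMulVec_apply, Pi.star_apply, h, h]

theorem isState_programState {L : Op (Fin d)} (hL : (Lᴴ * L).trace = 1) :
    IsState (programState L) := by
  refine ⟨Matrix.posSemidef_vecMulVec_self_star _, ?_⟩
  rw [← hL, Matrix.trace_mul_comm]
  simp only [Matrix.trace, Matrix.diag_apply, Fintype.sum_prod_type, programState_apply,
    Matrix.mul_apply, Matrix.conjTranspose_apply]

theorem append_programState_apply (L ρ : Op (Fin d)) (x y : Fin d × (Fin d × Fin d)) :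
    append (programState L) ρ x y = ρ x.1 y.1 * (L x.2.1 x.2.2 * star (L y.2.1 y.2.2)) := by
  rw [← programState_apply]; rfl

/-- To first order in time, the fixed Lindblad operator acts on the system as the encoded one. -/
theorem partialTrace_lindbladian_append (hd : d ≠ 0) (L ρ : Op (Fin d)) :
    partialTrace (lindbladian (fixedLindbladOp d) (append (programState L) ρ)) =
      lindbladian L ρ := by
  set V := appendMaxEnt d
  set Z := contractMaxEnt d with hZ
  set Y := append (programState L) ρ with hY
  -- The two factors `d^{-1/2}` cancel the `d = ⟨Γ|Γ⟩` that arises both in `M†M` and in tracing out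
  -- the fresh `|Γ⟩⟨Γ|`.
  have hc : ((1 / Real.sqrt d : ℝ) : ℂ) * ((1 / Real.sqrt d : ℝ) : ℂ) * d = 1 := by
    rw [← Complex.ofReal_mul, div_mul_div_comm, Real.mul_self_sqrt (Nat.cast_nonneg d)]
    push_cast
    field_simp
  have hMM : (fixedLindbladOp d)ᴴ * fixedLindbladOp d = Zᴴ * Z := by
    have h : (V * Z)ᴴ * (V * Z) = (d : ℂ) • (Zᴴ * Z) := by
      rw [Matrix.conjTranspose_mul, Matrix.mul_assoc, ← Matrix.mul_assoc Vᴴ,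
        conjTranspose_appendMaxEnt_mul_self, Matrix.smul_mul, Matrix.one_mul, Matrix.mul_smul]
    rw [fixedLindbladOp_eq, Matrix.conjTranspose_smul, Matrix.smul_mul, Matrix.mul_smul, h,
      Complex.star_def, Complex.conj_ofReal, smul_smul, smul_smul, hc, one_smul]
  -- Contracting the system index with the second index of the program amplitude `L p q` is matrix
  -- multiplication by `L`.
  have hZY : ∀ a x, (Z * Y) a x = (L * ρ) a x.1 * star (L x.2.1 x.2.2) := fun a x => by
    rw [contractMaxEnt_mul, Matrix.mul_apply, Finset.sum_mul]
    refine Finset.sum_congr rfl fun s _ => ?_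
    rw [hY, append_programState_apply]
    ring
  have hYZ : ∀ x a, (Y * Zᴴ) x a = L x.2.1 x.2.2 * (ρ * Lᴴ) x.1 a := fun x a => by
    rw [mul_conjTranspose_contractMaxEnt, Matrix.mul_apply, Finset.mul_sum]
    refine Finset.sum_congr rfl fun s _ => ?_
    rw [hY, append_programState_apply, Matrix.conjTranspose_apply]
    ring
  have hZYZ : Z * Y * Zᴴ = L * ρ * Lᴴ := by
    ext a b
    rw [mul_conjTranspose_contractMaxEnt, Matrix.mul_apply]
    exact Finset.sum_congr rfl fun s _ => by rw [hZY, Matrix.conjTranspose_apply]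
  have h1 : partialTrace (fixedLindbladOp d * Y * (fixedLindbladOp d)ᴴ) = L * ρ * Lᴴ := by
    have e : V * Z * Y * (V * Z)ᴴ = V * (L * ρ * Lᴴ) * Vᴴ := by
      rw [← hZYZ, Matrix.conjTranspose_mul]
      simp only [Matrix.mul_assoc]
    rw [fixedLindbladOp_eq, Matrix.conjTranspose_smul, Matrix.smul_mul, Matrix.smul_mul,
      Matrix.mul_smul, e, map_smul, map_smul, partialTrace_appendMaxEnt, Complex.star_def,
      Complex.conj_ofReal, smul_smul, smul_smul,
      hc, one_smul]
  -- `Z†` ties the row index `i` to `Q`, so the unused bra amplitude becomes `star (L p i)`; summing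
  -- over `p` multiplies by `L†`.
  have h2 : partialTrace (Zᴴ * Z * Y) = Lᴴ * L * ρ := by
    ext i j
    change ∑ x, (Zᴴ * Z * Y) (i, x) (j, x) = _
    rw [Matrix.mul_assoc, Matrix.mul_assoc, Matrix.mul_apply]
    simp only [conjTranspose_contractMaxEnt_mul, hZ, Fintype.sum_prod_type, Finset.sum_ite_eq,
      Finset.mem_univ, if_true]
    refine Finset.sum_congr rfl fun p _ => ?_
    rw [hZY, mul_comm, Matrix.conjTranspose_apply]
  have h3 : partialTrace (Y * (Zᴴ * Z)) = ρ * (Lᴴ * L) := by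
    ext i j
    change ∑ x, (Y * (Zᴴ * Z)) (i, x) (j, x) = _
    rw [← Matrix.mul_assoc, ← Matrix.mul_assoc, Matrix.mul_apply]
    simp only [mul_contractMaxEnt, hZ, Fintype.sum_prod_type, Finset.sum_ite_eq,
      Finset.mem_univ, if_true]
    refine Finset.sum_congr rfl fun p _ => ?_
    rw [hYZ, mul_comm]
  rw [lindbladian_apply, lindbladian_apply, map_sub, map_smul, map_add, hMM, h1, h2, h3]

end FirstOrder

/-! ### One step, all steps, and the copy count -/

variable {d : ℕ}

/-- The constant in the error estimate for one step of the algorithm. -/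
noncomputable def stepConst (d : ℕ) : ℝ :=
  2 + tailConst 1 + tailConst ((fixedLindbladOp d)ᴴ * fixedLindbladOp d).trace.re

theorem dominated_step (hd : d ≠ 0) {L : Op (Fin d)} (hL : (Lᴴ * L).trace = 1) {Δ : ℝ}
    (hΔ : 0 ≤ Δ) {r : ℕ} {ρ : Op (Fin r × Fin d)} (hρ : IsState ρ) :
    Dominated (ampliateMap (Fin r) (semigroup (lindbladian L) Δ) ρ -
      ampliateMap (Fin r) (step Δ (programState L)) ρ) (stepConst d * Δ ^ 2) := by
  have hψ := isState_programState hL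
  have c1 := tailConst_nonneg 1
  have c2 := tailConst_nonneg ((fixedLindbladOp d)ᴴ * fixedLindbladOp d).trace.re
  -- For `Δ > 1` the remainder estimate does not apply, but any two channels differ by at most `2 ≤
  -- 2Δ²`; this is the `2` in `stepConst`.
  obtain h | h := lt_or_ge 1 Δ
  · refine ((isChannel_semigroup_lindbladian L hΔ).dominated_sub (isChannel_step hΔ hψ) hρ).mono ?_
    unfold stepConst
    nlinarith
  · have happ := (isChannel_append (m := Fin d) hψ).isState hρ
    set Y := ampliateMap (Fin r) (append (m := Fin d) (programState L)) ρ with hY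
    have e0 : ampliateMap (Fin r) partialTrace Y = ρ := by
      rw [hY, ← ampliateMap_comp]
      have : partialTrace ∘ₗ append (m := Fin d) (programState L) = 1 :=
        LinearMap.ext (partialTrace_append hψ)
      rw [this]
      rfl
    have e1 : ampliateMap (Fin r) partialTrace
        (ampliateMap (Fin r) (lindbladian (fixedLindbladOp d)) Y) =
        ampliateMap (Fin r) (lindbladian L) ρ := by
      rw [hY, ← ampliateMap_comp, ← ampliateMap_comp]
      congr 2
      exact LinearMap.ext (partialTrace_lindbladian_append hd L)
    -- Orders zero and one agree with those of the exact evolution, so only the two tails survive in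
    -- the difference.
    have e2 : ampliateMap (Fin r) (step Δ (programState L)) ρ =
        ρ + (Δ : ℂ) • ampliateMap (Fin r) (lindbladian L) ρ +
          ampliateMap (Fin r) partialTrace
            (semigroupTail (ampliateMap (Fin r) (lindbladian (fixedLindbladOp d))) Δ Y) := by
      unfold step
      rw [ampliateMap_comp, ampliateMap_comp, ← hY, ampliateMap_semigroup,
        semigroup_eq_add_semigroupTail, map_add, map_add, map_smul, e0, e1]
    rw [e2, ampliateMap_semigroup, semigroup_eq_add_semigroupTail, add_sub_add_left_eq_sub]
    have d1 := dominated_semigroupTail_ampliateMap L r hΔ h hρ.1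
    have d2 := (dominated_semigroupTail_ampliateMap (fixedLindbladOp d) r hΔ h happ.1).map
      (isChannel_partialTrace.isPositive r) (trace_ampliateMap isChannel_partialTrace.trace_eq)
    refine (d1.sub d2).mono ?_
    -- Normalization `Tr L†L = 1` turns the tail constant of `L` into `tailConst 1`, uniform in `L`.
    rw [hL, hρ.2, happ.2, Complex.one_re, mul_one, mul_one]
    unfold stepConst
    nlinarith [sq_nonneg Δ]

theorem foldl_step_replicate (Δ : ℝ) (σ : Op (Fin d × Fin d)) (n : ℕ)
    (N : SuperOp (Fin d) (Fin d)) :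
    (List.replicate n σ).foldl (fun N σ => step Δ σ ∘ₗ N) N = step Δ σ ^ n * N := by
  induction n generalizing N with
  | zero => rw [pow_zero, one_mul]; rfl
  | succ n ih => rw [List.replicate_succ, List.foldl_cons, ih, pow_succ, mul_assoc]; rfl

theorem algorithm_replicate (t : ℝ) (σ : Op (Fin d × Fin d)) (n : ℕ) :
    algorithm t (List.replicate n σ) = step (t / n) σ ^ n := by
  unfold algorithm
  rw [foldl_step_replicate, List.length_replicate]
  exact mul_one _

theorem diamondDist_algorithm_le (hd : d ≠ 0) {L : Op (Fin d)} (hL : (Lᴴ * L).trace = 1) {t : ℝ}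
    (ht : 0 ≤ t) {n : ℕ} (hn : n ≠ 0) :
    diamondDist (semigroup (lindbladian L) t)
        (algorithm t (List.replicate n (programState L))) ≤
      ENNReal.ofReal (stepConst d * t ^ 2 / n) := by
  refine iSup_le fun r => iSup_le fun ρ => iSup_le fun hρ => ENNReal.ofReal_le_ofReal ?_
  have hn' : (n : ℝ) ≠ 0 := Nat.cast_ne_zero.2 hn
  have hΔ : 0 ≤ t / n := by positivity
  -- The exact evolution is also an `n`-th power, so the errors accumulate to `n · stepConst d ·
  -- (t/n)²`.
  have e : semigroup (lindbladian L) t = semigroup (lindbladian L) (t / n) ^ n := by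
    rw [← semigroup_natCast_mul, mul_div_cancel₀ t hn']
  rw [algorithm_replicate, e]
  refine Dominated.schattenNorm_le (((isChannel_semigroup_lindbladian L hΔ).dominated_pow_sub_pow
    (isChannel_step hΔ (isState_programState hL)) (fun ρ hρ => dominated_step hd hL hΔ hρ) hρ
    n).mono (le_of_eq ?_))
  field_simp

end WaveMatrix

/-- For every dimension `d` there is a constant `C` such that `n₀ ≤ C t²/ε + 1` copies of the program
state suffice, and so does every larger number of copies, uniformly in the encoded operator `L`,
the time `t` and the accuracy `ε`. -/
theorem theorem1 (d : ℕ) :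
    ∃ C : ℝ, 0 < C ∧
      ∀ L : Matrix (Fin d) (Fin d) ℂ, WaveMatrix.schattenNorm 2 L = 1 →
        ∀ t : ℝ, 0 ≤ t → ∀ ε : ℝ, 0 < ε → ε < 1 →
          ∃ n₀ : ℕ, 0 < n₀ ∧ (n₀ : ℝ) ≤ C * (t ^ 2 / ε) + 1 ∧
            ∀ n : ℕ, n₀ ≤ n →
              WaveMatrix.diamondDist
                  (WaveMatrix.semigroup (WaveMatrix.lindbladian L) t)
                  (WaveMatrix.algorithm t (List.replicate n (WaveMatrix.programState L))) / 2
                ≤ ENNReal.ofReal ε := by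
  have hC : 0 < WaveMatrix.stepConst d := by
    have c1 := WaveMatrix.tailConst_nonneg 1
    have c2 := WaveMatrix.tailConst_nonneg
      ((WaveMatrix.fixedLindbladOp d)ᴴ * WaveMatrix.fixedLindbladOp d).trace.re
    unfold WaveMatrix.stepConst
    linarith
  refine ⟨WaveMatrix.stepConst d, hC, fun L hL t ht ε hε _ => ?_⟩
  have hL' := WaveMatrix.schattenNorm_two_eq_one hL
  -- In dimension zero every trace vanishes, so no `L` is normalized.
  have hd : d ≠ 0 := by
    rintro rfl
    simp [Matrix.trace] at hL'
  -- Floor plus one keeps `n₀` positive even when `t = 0`, and still at most `C t²/ε + 1`.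
  refine ⟨⌊WaveMatrix.stepConst d * (t ^ 2 / ε)⌋₊ + 1, Nat.succ_pos _, ?_, fun n hn => ?_⟩
  · push_cast
    exact add_le_add_left (Nat.floor_le (by positivity)) 1
  · have hn0 : 0 < n := (Nat.succ_pos _).trans_le hn
    have hlt : WaveMatrix.stepConst d * (t ^ 2 / ε) < n :=
      (Nat.lt_floor_add_one _).trans_le (by exact_mod_cast hn)
    have hle : WaveMatrix.stepConst d * t ^ 2 / n ≤ ε := by
      rw [← mul_div_assoc, div_lt_iff₀ hε] at hlt
      rw [div_le_iff₀ (by positivity)]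
      linarith
    -- The unhalved diamond distance is already at most `ε`; the factor `1/2` is slack.
    refine (ENNReal.div_le_of_le_mul ?_)
    refine (WaveMatrix.diamondDist_algorithm_le hd hL' ht hn0.ne').trans ?_
    refine (ENNReal.ofReal_le_ofReal hle).trans ?_
    exact le_mul_of_one_le_right (zero_le) (by norm_num)
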